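/- Let $\mathcal W,\mathcal X,\hat{\mathcal W}$ be measurable spaces, $\mathcal P_W$ a probability measure on $\mathcal W$, $(\mathcal P_{X|W=w})_{w\in\mathcal W}$ a Markov kernel from $\mathcal W$ to $\mathcal X$, and $\ell:\mathcal W\times\hat{\mathcal W}\to[0,\infty)$ a measurable loss. Let $\mathcal P_{WX}$ be the induced joint law of $(W,X)$. For a measurable estimator $\phi:\mathcal X\to\hat{\mathcal W}$ put $\hat W=\phi(X)$, let $\mathcal P_{W\hat W}$ be the law of $(W,\hat W)$ and $\mathcal P_{\hat W}$ the law of $\hat W$. The Bayes risk is $R_B=\inf_\phi \mathcal P_{W\hat W}(\ell)$, where $\mu(f)=\int f\,d\mu$ and the infimum is over all measurable $\phi$. Write $\mu^{s}(f)=\left(\int f\,d\mu\right)^{s}$, and let $\frac{d\mathcal P_{W\hat W}}{d\mathcal P_W\mathcal P_{\hat W}}$ be the Radon–Nikodym derivative with respect to the product of the marginals (the density of the absolutely continuous part, if $\mathcal P_{W\hat W}$ is not absolutely continuous). Conventions: $0^{s}=\infty$ and $\infty^{s}=0$ for $s<0$, $0\cdot\infty=0$. For $\alpha\in(0,1)$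 the Rényi divergence is $D_\alpha(P\|Q)=\frac1{\alpha-1}\log\int p^\alpha q^{1-\alpha}\,d\mu\in[0,\infty]$ ($p,q$ densities of $P,Q$ with respect to a common dominating measure $\mu$), and for a pair $(U,V)$ with joint law $\mathcal P_{UV}$, Sibson's mutual information is $I_\alpha(U,V)=\inf_{Q}D_\alpha(\mathcal P_{UV}\|\mathcal P_U\otimes Q)$, the infimum being over probability measures $Q$ on the space of $V$. 1. For every measurable $\phi$ and all real $\alpha,\alpha'<1$, $\alpha,\alpha'\neq0$, with $\frac1\alpha+\frac1\beta=1=\frac1{\alpha'}+\frac1{\beta'}$, $$\mathcal P_{W\hat W}(\ell)\ \ge\ \mathcal P_{\hat W}^{\frac1{\beta'}}\!\left(\mathcal P_W^{\frac{\beta'}{\beta}}\!\left(\ell^{\beta}\right)\right)\cdot \mathcal P_{\hat W}^{\frac1{\alpha'}}\!\left(\mathcal P_W^{\frac{\alpha'}{\alpha}}\!\left(\left(\frac{d\mathcal P_{W\hat W}}{d\mathcal P_W\mathcal P_{\hat W}}\right)^{\alpha}\right)\right).$$ 2. Let $0<\alpha<1$ and $\frac1\alpha+\frac1\beta=1$.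 For every measurable $\phi$, as $\alpha'\to1^-$ (so that $\beta'=\frac{\alpha'}{\alpha'-1}\to-\infty$) the right-hand side above converges to $$\operatorname*{ess\,inf}_{\mathcal P_{\hat W}}\left(\mathcal P_W^{\frac1\beta}\!\left(\ell(W,\hat W)^{\beta}\right)\right)\cdot\exp\!\left(\frac{\alpha-1}{\alpha}I_\alpha(W,\hat W)\right).$$ Moreover, for every measurable $\phi$, $$\mathcal P_{W\hat W}(\ell)\ \ge\ \operatorname*{ess\,inf}_{\mathcal P_{\hat W}}\left(\mathcal P_W^{\frac1\beta}\!\left(\ell(W,\hat W)^{\beta}\right)\right)\cdot\exp\!\left(\frac{\alpha-1}{\alpha}I_\alpha(W,X)\right),$$ and consequently $$R_B\ \ge\ \left(\inf_{\phi}\ \operatorname*{ess\,inf}_{\mathcal P_{\hat W}}\left(\mathcal P_W^{\frac1\beta}\!\left(\ell(W,\hat W)^{\beta}\right)\right)\right)\cdot\exp\!\left(\frac{\alpha-1}{\alpha}I_\alpha(W,X)\right).$$ -/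

import Mathlib

open MeasureTheory ProbabilityTheory Filter Topology
open scoped ENNReal NNReal

noncomputable section

namespace BayesFramework

/-- The law of `(W, Ŵ)`, where `W ∼ PW`, `X ∼ K w` given `W = w`, and `Ŵ = φ X`. -/
def estimatorLaw {𝒲 𝒳 𝒱 : Type*} [MeasurableSpace 𝒲] [MeasurableSpace 𝒳] [MeasurableSpace 𝒱]
    (PW : Measure 𝒲) (K : Kernel 𝒲 𝒳) (φ : 𝒳 → 𝒱) : Measure (𝒲 × 𝒱) :=
  (PW ⊗ₘ K).map (fun z => (z.1, φ z.2))

/-- The expected loss of the (deterministic) estimator `φ`. -/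
def expectedLoss {𝒲 𝒳 𝒱 : Type*} [MeasurableSpace 𝒲] [MeasurableSpace 𝒳] [MeasurableSpace 𝒱]
    (PW : Measure 𝒲) (K : Kernel 𝒲 𝒳) (ℓ : 𝒲 → 𝒱 → ℝ≥0) (φ : 𝒳 → 𝒱) : ℝ≥0∞ :=
  ∫⁻ z, (ℓ z.1 z.2 : ℝ≥0∞) ∂(estimatorLaw PW K φ)

/-- The Bayes risk: the infimum of the expected loss over all measurable estimators `φ : 𝒳 → 𝒱`. -/
def bayesRisk {𝒲 𝒳 𝒱 : Type*} [MeasurableSpace 𝒲] [MeasurableSpace 𝒳] [MeasurableSpace 𝒱]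
    (PW : Measure 𝒲) (K : Kernel 𝒲 𝒳) (ℓ : 𝒲 → 𝒱 → ℝ≥0) : ℝ≥0∞ :=
  ⨅ (φ : 𝒳 → 𝒱) (_ : Measurable φ), expectedLoss PW K ℓ φ

/-- The Rényi divergence of order `α`,
`D_α(P‖Q) = (α - 1)⁻¹ log ∫ p ^ α q ^ (1 - α) dμ`, with the dominating measure `μ = P + Q` and
`p`, `q` the densities of `P`, `Q` with respect to `μ`. The value is an extended real number. -/
def renyiDiv {Ω : Type*} [MeasurableSpace Ω] (α : ℝ) (P Q : Measure Ω) : EReal :=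
  (((α - 1)⁻¹ : ℝ) : EReal) *
    ENNReal.log (∫⁻ x, (P.rnDeriv (P + Q) x) ^ α * (Q.rnDeriv (P + Q) x) ^ (1 - α) ∂(P + Q))

/-- Sibson's mutual information of order `α` of a pair `(X, Y)` with joint law `P`:
the infimum over probability measures `Q` on the second factor of `D_α(P ‖ P_X ⊗ Q)`. -/
def sibsonInfo {𝒳 𝒴 : Type*} [MeasurableSpace 𝒳] [MeasurableSpace 𝒴] (α : ℝ)
    (P : Measure (𝒳 × 𝒴)) : EReal :=
  ⨅ Q : ProbabilityMeasure 𝒴, renyiDiv α P (P.fst.prod (Q : Measure 𝒴))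

/-- The nested (pseudo-)norm `(∫ (∫ g(w, v) ^ p μ(dw)) ^ (p' / p) ν(dv)) ^ (1 / p')`, with the
conventions `0 ^ s = ∞` and `∞ ^ s = 0` for `s < 0`. -/
def nestedNorm {𝒲 𝒱 : Type*} [MeasurableSpace 𝒲] [MeasurableSpace 𝒱]
    (μ : Measure 𝒲) (ν : Measure 𝒱) (p p' : ℝ) (g : 𝒲 → 𝒱 → ℝ≥0∞) : ℝ≥0∞ :=
  (∫⁻ v, (∫⁻ w, g w v ^ p ∂μ) ^ (p' / p) ∂ν) ^ (1 / p')

/-- The right-hand side of the reverse Hölder bound for a joint law `P` on `𝒲 × 𝒱` and a loss `ℓ`: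
the nested norm of `ℓ` with exponents `(β, β')` times the nested norm of the density of `P` with
respect to the product of its marginals, with exponents `(α, α')`. -/
def reverseHolderBound {𝒲 𝒱 : Type*} [MeasurableSpace 𝒲] [MeasurableSpace 𝒱]
    (P : Measure (𝒲 × 𝒱)) (ℓ : 𝒲 → 𝒱 → ℝ≥0) (α β α' β' : ℝ) : ℝ≥0∞ :=
  nestedNorm P.fst P.snd β β' (fun w v => (ℓ w v : ℝ≥0∞)) *
    nestedNorm P.fst P.snd α α' (fun w v => P.rnDeriv (P.fst.prod P.snd) (w, v))

/-- `ess inf` over `v ∼ ν` of `(∫ ℓ(w, v) ^ β μ(dw)) ^ (1 / β)`. -/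
def essInfNorm {𝒲 𝒱 : Type*} [MeasurableSpace 𝒲] [MeasurableSpace 𝒱]
    (μ : Measure 𝒲) (ν : Measure 𝒱) (β : ℝ) (ℓ : 𝒲 → 𝒱 → ℝ≥0) : ℝ≥0∞ :=
  essInf (fun v => (∫⁻ w, (ℓ w v : ℝ≥0∞) ^ β ∂μ) ^ (1 / β)) ν

end BayesFramework

end

/-! Hölder's inequality reverses for exponents below 1 (`reverse_holder`). Let `f` be the density of
the absolutely continuous part of the joint law. The expected loss is at least the double integral
of `ℓ * f` against the product of the marginals. Reverse Hölder in `w` with `(α, β)` and in `v` with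
`(α', β')` then gives the nested bound.

As `α' → 1⁻`, `β' → -∞`: the loss factor tends to an essential infimum, the density factor to `J =
sibsonIntegral α P`. This `J` encodes Sibson's information because the infimum over `Q` is explicit.
By ordinary Hölder the Hellinger integral of `P` against `P.fst ⊗ Q` is at most `J ^ α`, with
equality, when `J ≠ 0`, for `Q` proportional to `(∫ f ^ α dP.fst) ^ (1 / α)` relative to `P.snd`
(`exp_mul_sibsonInfo`).

Finally, data processing gives `I_α(W, Ŵ) ≤ I_α(W, X)` (`sibsonInfo_map_le`). Since `(α - 1) / α <
0`, passing to `X` only lowers the bound and removes `φ` from the exponential factor. -/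

namespace BayesFramework

/-! ### Reverse Hölder inequality and the nested bound -/

section ReverseHolder

variable {Ω : Type*} [MeasurableSpace Ω] {μ : Measure Ω}

/-- Since `β (1 - α) = -α`, one has `f ^ α = (g f) ^ α (g ^ β) ^ (1 - α)`. Ordinary Hölder with
weights `α` and `1 - α`, solved for `∫ g f`, is the claim; the degenerate values are split off
first. -/
theorem reverse_holder_of_pos {f g : Ω → ℝ≥0∞} (hf : AEMeasurable f μ) (hg : AEMeasurable g μ)
    {α β : ℝ} (h0 : 0 < α) (h1 : α < 1) (hαβ : 1 / α + 1 / β = 1) :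
    (∫⁻ x, g x ^ β ∂μ) ^ (1 / β) * (∫⁻ x, f x ^ α ∂μ) ^ (1 / α) ≤ ∫⁻ x, g x * f x ∂μ := by
  have hinv : 1 / β = -((1 - α) / α) := by
    rw [eq_sub_of_add_eq' hαβ]; field_simp; ring
  have hβ0 : β < 0 := by
    refine one_div_neg.1 ?_
    rw [hinv, neg_lt_zero]
    exact div_pos (by linarith) h0
  have hβ : β = -(α / (1 - α)) := by
    have := congrArg (fun x => 1 / x) hinv
    simp only [one_div_one_div] at this
    rw [this, one_div, inv_neg, inv_div]
  by_cases htop : ∫⁻ x, g x * f x ∂μ = ∞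
  · rw [htop]; exact le_top
  by_cases hz : ∫⁻ x, g x ^ β ∂μ = ∞
  · rw [hz, ENNReal.top_rpow_of_neg (by simpa using hβ0), zero_mul]; exact zero_le
  have hfin : ∀ᵐ x ∂μ, g x * f x ≠ ∞ := by
    filter_upwards [ae_lt_top' (hg.mul hf) htop] with x hx using hx.ne
  have hpos : ∀ᵐ x ∂μ, g x ≠ 0 := by
    filter_upwards [ae_lt_top' (hg.pow_const β) hz] with x hx h
    simp [h, ENNReal.zero_rpow_of_neg hβ0] at hx
  have key : ∫⁻ x, f x ^ α ∂μ ≤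
      (∫⁻ x, g x * f x ∂μ) ^ α * (∫⁻ x, g x ^ β ∂μ) ^ (1 - α) := by
    refine le_trans (lintegral_mono_ae ?_) (ENNReal.lintegral_mul_norm_pow_le (hg.mul hf)
      (hg.pow_const β) h0.le (sub_nonneg.2 h1.le) (by ring))
    filter_upwards [hfin, hpos] with x hx hx0
    have hexp : (g x ^ β) ^ (1 - α) = (g x ^ α)⁻¹ := by
      rw [← ENNReal.rpow_mul, ← ENNReal.rpow_neg, hβ]
      congr 1
      have : (1 - α) ≠ 0 := by linarith
      field_simp
    simp only [Pi.mul_apply]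
    rw [hexp, ENNReal.mul_rpow_of_nonneg _ _ h0.le]
    -- The factorization fails at `g x = ∞`, but there finiteness of `g x * f x` forces `f x = 0`.
    by_cases hgt : g x = ∞
    · have : f x = 0 := by
        by_contra hne
        exact hx (by rw [hgt, ENNReal.top_mul hne])
      rw [this, ENNReal.zero_rpow_of_pos h0]; exact zero_le
    · rw [mul_right_comm, ENNReal.mul_inv_cancel, one_mul]
      · simp [ENNReal.rpow_eq_zero_iff, hx0, hgt]
      · simp [ENNReal.rpow_eq_top_iff, hx0, hgt]
  set G := ∫⁻ x, g x ^ β ∂μ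
  calc G ^ (1 / β) * (∫⁻ x, f x ^ α ∂μ) ^ (1 / α)
      ≤ G ^ (1 / β) * ((∫⁻ x, g x * f x ∂μ) ^ α * G ^ (1 - α)) ^ (1 / α) := by gcongr
    _ = (∫⁻ x, g x * f x ∂μ) * (G ^ (1 / β) * (G ^ (1 / β))⁻¹) := by
        rw [ENNReal.mul_rpow_of_nonneg _ _ (by positivity), ← ENNReal.rpow_mul,
          ← ENNReal.rpow_mul, mul_one_div_cancel h0.ne', ENNReal.rpow_one,
          ← ENNReal.rpow_neg, hinv, neg_neg, mul_one_div, mul_left_comm]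
    _ ≤ ∫⁻ x, g x * f x ∂μ := by
        exact (mul_le_mul_right (ENNReal.mul_inv_le_one _) _).trans_eq (mul_one _)

theorem reverse_holder {f g : Ω → ℝ≥0∞} (hf : AEMeasurable f μ) (hg : AEMeasurable g μ)
    {α β : ℝ} (h0 : α ≠ 0) (h1 : α < 1) (hαβ : 1 / α + 1 / β = 1) :
    (∫⁻ x, g x ^ β ∂μ) ^ (1 / β) * (∫⁻ x, f x ^ α ∂μ) ^ (1 / α) ≤ ∫⁻ x, g x * f x ∂μ := by
  -- If `α < 0` then `0 < β < 1`, so the positive case applies with `f` and `g` exchanged.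
  rcases h0.lt_or_gt with h | h
  · have h1β : 1 < 1 / β := by have := one_div_neg.2 h; linarith
    have hβ0 : 0 < β := one_div_pos.1 (by linarith)
    have hβ1 : β < 1 := by
      rw [lt_div_iff₀ hβ0] at h1β; linarith
    have := reverse_holder_of_pos hg hf hβ0 hβ1 (by rw [add_comm]; exact hαβ)
    simpa only [mul_comm] using this
  · exact reverse_holder_of_pos hf hg h h1 hαβ

end ReverseHolder

theorem reverseHolderBound_le {𝒲 𝒱 : Type*} [MeasurableSpace 𝒲] [MeasurableSpace 𝒱]
    (P : Measure (𝒲 × 𝒱)) [IsFiniteMeasure P] {ℓ : 𝒲 → 𝒱 → ℝ≥0}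
    (hℓ : Measurable (Function.uncurry ℓ)) {α β α' β' : ℝ} (hα : α < 1) (hα0 : α ≠ 0)
    (hα' : α' < 1) (hα'0 : α' ≠ 0) (h : 1 / α + 1 / β = 1) (h' : 1 / α' + 1 / β' = 1) :
    reverseHolderBound P ℓ α β α' β' ≤ ∫⁻ z, (ℓ z.1 z.2 : ℝ≥0∞) ∂P := by
  set f := P.rnDeriv (P.fst.prod P.snd)
  have hf : Measurable f := Measure.measurable_rnDeriv _ _
  have hℓ' : Measurable fun z : 𝒲 × 𝒱 => (ℓ z.1 z.2 : ℝ≥0∞) :=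
    measurable_coe_nnreal_ennreal.comp hℓ
  have hA : Measurable fun v => (∫⁻ w, (ℓ w v : ℝ≥0∞) ^ β ∂P.fst) ^ (1 / β) :=
    (Measurable.lintegral_prod_left' (f := fun z : 𝒲 × 𝒱 => (ℓ z.1 z.2 : ℝ≥0∞) ^ β)
      (hℓ'.pow_const β)).pow_const _
  have hB : Measurable fun v => (∫⁻ w, f (w, v) ^ α ∂P.fst) ^ (1 / α) :=
    (Measurable.lintegral_prod_left' (f := fun z : 𝒲 × 𝒱 => f z ^ α)
      (hf.pow_const α)).pow_const _
  calc reverseHolderBound P ℓ α β α' β'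
      = (∫⁻ v, ((∫⁻ w, (ℓ w v : ℝ≥0∞) ^ β ∂P.fst) ^ (1 / β)) ^ β' ∂P.snd) ^ (1 / β') *
        (∫⁻ v, ((∫⁻ w, f (w, v) ^ α ∂P.fst) ^ (1 / α)) ^ α' ∂P.snd) ^ (1 / α') := by
        simp only [reverseHolderBound, nestedNorm, ← ENNReal.rpow_mul, one_div_mul_eq_div, f]
    _ ≤ ∫⁻ v, (∫⁻ w, (ℓ w v : ℝ≥0∞) ^ β ∂P.fst) ^ (1 / β) *
          (∫⁻ w, f (w, v) ^ α ∂P.fst) ^ (1 / α) ∂P.snd :=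
        reverse_holder hB.aemeasurable hA.aemeasurable hα'0 hα' h'
    _ ≤ ∫⁻ v, ∫⁻ w, (ℓ w v : ℝ≥0∞) * f (w, v) ∂P.fst ∂P.snd :=
        lintegral_mono fun v => reverse_holder
          (hf.comp measurable_prodMk_right).aemeasurable
          (hℓ'.comp measurable_prodMk_right).aemeasurable hα0 hα h
    _ = ∫⁻ z, f z * (ℓ z.1 z.2 : ℝ≥0∞) ∂(P.fst.prod P.snd) := by
        rw [lintegral_prod_symm' (fun z : 𝒲 × 𝒱 => f z * (ℓ z.1 z.2 : ℝ≥0∞)) (hf.mul hℓ')]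
        simp only [mul_comm]
    _ = ∫⁻ z, (ℓ z.1 z.2 : ℝ≥0∞) ∂((P.fst.prod P.snd).withDensity f) :=
        (lintegral_withDensity_eq_lintegral_mul _ hf hℓ').symm
    -- Dropping the singular part of `P` only decreases the integral, so absolute continuity is not
    -- needed.
    _ ≤ ∫⁻ z, (ℓ z.1 z.2 : ℝ≥0∞) ∂P := lintegral_mono' (Measure.withDensity_rnDeriv_le _ _) le_rfl

/-! ### Limits of power means as the exponent tends to `∞`, `-∞` and `1` -/

section Limits

variable {Ω : Type*} [MeasurableSpace Ω] {ν : Measure Ω} [IsProbabilityMeasure ν]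

theorem tendsto_rpow_of_ne_top {ι : Type*} {l : Filter ι} {u : ι → ℝ≥0∞} {v : ι → ℝ}
    {x : ℝ≥0∞} {y : ℝ} (hu : Tendsto u l (𝓝 x)) (hv : Tendsto v l (𝓝 y)) (hx : x ≠ ∞)
    (h : x ≠ 0 ∨ 0 < y) : Tendsto (fun i => u i ^ v i) l (𝓝 (x ^ y)) := by
  have hlim : Tendsto (fun i => (((u i).toNNReal ^ v i : ℝ≥0) : ℝ≥0∞)) l
      (𝓝 ((x.toNNReal ^ y : ℝ≥0) : ℝ≥0∞)) :=
    ENNReal.tendsto_coe.2 (((ENNReal.tendsto_toNNReal hx).comp hu).nnrpow hv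
      (h.imp_left fun h0 => by simp [ENNReal.toNNReal_eq_zero_iff, h0, hx]))
  have hcoe : ∀ {a : ℝ≥0∞} {b : ℝ}, a ≠ ∞ → (a ≠ 0 ∨ 0 < b) →
      ((a.toNNReal ^ b : ℝ≥0) : ℝ≥0∞) = a ^ b := by
    intro a b ha hab
    lift a to ℝ≥0 using ha
    rcases hab with h0 | h0
    · exact ENNReal.coe_rpow_of_ne_zero (by simpa using h0) b
    · exact ENNReal.coe_rpow_of_nonneg a h0.le
  rw [hcoe hx h] at hlim
  refine hlim.congr' ?_
  have hev : ∀ᶠ i in l, u i ≠ 0 ∨ 0 < v i := h.elim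
    (fun h0 => (hu.eventually_ne h0).mono fun _ => Or.inl)
    (fun h0 => (hv.eventually (lt_mem_nhds h0)).mono fun _ => Or.inr)
  filter_upwards [hu.eventually_ne hx, hev] with i hi hi' using hcoe hi hi'

/-- For `c` below the essential supremum, Markov's inequality bounds the mean below by `c * ν {c <
f} ^ (1 / p)`, which tends to `c`; the upper bound uses that `ν` has mass 1. -/
theorem tendsto_lintegral_rpow_atTop_essSup {f : Ω → ℝ≥0∞} (hf : Measurable f) :
    Tendsto (fun p : ℝ => (∫⁻ x, f x ^ p ∂ν) ^ (1 / p)) atTop (𝓝 (essSup f ν)) := by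
  refine tendsto_order.2 ⟨fun d hd => ?_, fun d hd => ?_⟩
  · obtain ⟨c, hdc, hc⟩ := exists_between hd
    have hS : ν {x | c < f x} ≠ 0 := fun h => hc.not_ge (essSup_le_of_ae_le c (by
      simpa [Filter.EventuallyLE, ae_iff] using h))
    have hlim : Tendsto (fun p : ℝ => c * ν {x | c < f x} ^ (1 / p)) atTop (𝓝 c) := by
      have h1 : Tendsto (fun p : ℝ => ν {x | c < f x} ^ (1 / p)) atTop (𝓝 1) := by
        have h2 : Tendsto (fun p : ℝ => 1 / p) atTop (𝓝 0) := by
          simpa using tendsto_inv_atTop_zero (𝕜 := ℝ)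
        simpa using tendsto_rpow_of_ne_top (tendsto_const_nhds (x := ν {x | c < f x})) h2
          (measure_ne_top _ _) (Or.inl hS)
      simpa using ENNReal.Tendsto.const_mul h1 (Or.inl one_ne_zero)
    filter_upwards [(tendsto_order.1 hlim).1 d hdc, eventually_gt_atTop 0] with p hp hp0
    refine hp.trans_le ?_
    calc c * ν {x | c < f x} ^ (1 / p) = (c ^ p * ν {x | c < f x}) ^ (1 / p) := by
          rw [ENNReal.mul_rpow_of_nonneg _ _ (by positivity), ← ENNReal.rpow_mul,
            mul_one_div_cancel hp0.ne', ENNReal.rpow_one]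
      _ ≤ (c ^ p * ν {x | c ^ p ≤ f x ^ p}) ^ (1 / p) := by
          gcongr with x
          exact fun h => ENNReal.rpow_le_rpow h.le hp0.le
      _ ≤ (∫⁻ x, f x ^ p ∂ν) ^ (1 / p) := by
          gcongr
          exact mul_meas_ge_le_lintegral (hf.pow_const p) _
  · filter_upwards [eventually_gt_atTop 0] with p hp0
    refine lt_of_le_of_lt ?_ hd
    calc (∫⁻ x, f x ^ p ∂ν) ^ (1 / p) ≤ (∫⁻ _, essSup f ν ^ p ∂ν) ^ (1 / p) := by
          refine ENNReal.rpow_le_rpow (lintegral_mono_ae ?_) (by positivity)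
          filter_upwards [ENNReal.ae_le_essSup f] with x hx using ENNReal.rpow_le_rpow hx hp0.le
      _ = essSup f ν := by
          rw [lintegral_const, measure_univ, mul_one, ← ENNReal.rpow_mul,
            mul_one_div_cancel hp0.ne', ENNReal.rpow_one]

theorem inv_essSup_inv (f : Ω → ℝ≥0∞) (ν : Measure Ω) :
    (essSup (fun x => (f x)⁻¹) ν)⁻¹ = essInf f ν := by
  have h := OrderIso.essInf_apply f ν OrderIso.invENNReal
  have h' : (essInf f ν)⁻¹ = essSup (fun x => (f x)⁻¹) ν := h
  rw [← h', inv_inv]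

/-- With `p = a / (1 - a) → ∞`, the mean of `f` of exponent `-p` is the inverse of the `p`-mean of
`f⁻¹`. -/
theorem tendsto_lintegral_rpow_essInf {f : Ω → ℝ≥0∞} (hf : Measurable f) :
    Tendsto (fun a : ℝ => (∫⁻ x, f x ^ (a / (a - 1)) ∂ν) ^ (1 / (a / (a - 1)))) (𝓝[<] 1)
      (𝓝 (essInf f ν)) := by
  rw [← inv_essSup_inv]
  have hp : Tendsto (fun a : ℝ => a * (1 - a)⁻¹) (𝓝[<] 1) atTop := by
    refine Tendsto.pos_mul_atTop one_pos (tendsto_id.mono_left nhdsWithin_le_nhds) ?_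
    refine tendsto_inv_nhdsGT_zero.comp (tendsto_nhdsWithin_iff.2 ⟨?_, ?_⟩)
    · have : Tendsto (fun a : ℝ => 1 - a) (𝓝 1) (𝓝 (1 - 1)) := tendsto_const_nhds.sub tendsto_id
      rw [sub_self] at this
      exact this.mono_left nhdsWithin_le_nhds
    · filter_upwards [self_mem_nhdsWithin] with a ha
      exact sub_pos.2 (Set.mem_Iio.1 ha)
  refine (tendsto_inv_iff.2
    ((tendsto_lintegral_rpow_atTop_essSup (ν := ν) hf.inv).comp hp)).congr fun a => ?_
  have : a / (a - 1) = -(a * (1 - a)⁻¹) := by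
    rw [← neg_sub 1 a, div_neg, div_eq_mul_inv]
  simp only [Function.comp_apply, this, Pi.inv_apply, ENNReal.inv_rpow, ENNReal.rpow_neg, one_div,
    inv_neg]

theorem tendsto_lintegral_rpow_one {f : Ω → ℝ≥0∞} (hf : Measurable f)
    (hfin : ∫⁻ x, f x ∂ν ≠ ∞) :
    Tendsto (fun a : ℝ => (∫⁻ x, f x ^ a ∂ν) ^ (1 / a)) (𝓝[<] 1) (𝓝 (∫⁻ x, f x ∂ν)) := by
  have ha : Tendsto (fun a : ℝ => a) (𝓝[<] 1) (𝓝 1) := tendsto_id.mono_left nhdsWithin_le_nhds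
  have hpos : ∀ᶠ a : ℝ in 𝓝[<] 1, 0 < a := ha.eventually (lt_mem_nhds one_pos)
  have hint : Tendsto (fun a : ℝ => ∫⁻ x, f x ^ a ∂ν) (𝓝[<] 1) (𝓝 (∫⁻ x, f x ∂ν)) := by
    refine tendsto_lintegral_filter_of_dominated_convergence (fun x => 1 + f x)
      (Eventually.of_forall fun a => hf.pow_const a) ?_ ?_ ?_
    · filter_upwards [self_mem_nhdsWithin, hpos] with a ha1 ha0
      refine ae_of_all _ fun x => ?_
      rcases le_total (f x) 1 with hx | hx
      · exact (ENNReal.rpow_le_one hx ha0.le).trans le_self_add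
      · refine (ENNReal.rpow_le_rpow_of_exponent_le hx (le_of_lt ha1)).trans ?_
        rw [ENNReal.rpow_one]
        exact le_add_self
    · rw [lintegral_add_left measurable_const]
      simpa using hfin
    · filter_upwards [ae_lt_top hf hfin] with x hx
      simpa using tendsto_rpow_of_ne_top (tendsto_const_nhds (x := f x)) ha hx.ne
        (Or.inr one_pos)
  have h1 : Tendsto (fun a : ℝ => 1 / a) (𝓝[<] 1) (𝓝 1) := by
    simpa using ha.inv₀ one_ne_zero
  simpa using tendsto_rpow_of_ne_top hint h1 hfin (Or.inr one_pos)

end Limits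

/-- The mixed norm `∫ (∫ f(w, v) ^ α μ(dw)) ^ (1 / α) ν(dv)` of the density `f` of `P` with respect
to the product of its marginals `μ` and `ν`. -/
noncomputable def sibsonIntegral {𝒲 𝒱 : Type*} [MeasurableSpace 𝒲] [MeasurableSpace 𝒱] (α : ℝ)
    (P : Measure (𝒲 × 𝒱)) : ℝ≥0∞ :=
  ∫⁻ v, (∫⁻ w, P.rnDeriv (P.fst.prod P.snd) (w, v) ^ α ∂P.fst) ^ (1 / α) ∂P.snd

/-! ### Passing to the limit in the nested bound -/

section Mixed

variable {𝒲 𝒱 : Type*} [MeasurableSpace 𝒲] [MeasurableSpace 𝒱] (P : Measure (𝒲 × 𝒱))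

theorem measurable_lintegral_rnDeriv_rpow [IsFiniteMeasure P] (α : ℝ) :
    Measurable fun v => ∫⁻ w, P.rnDeriv (P.fst.prod P.snd) (w, v) ^ α ∂P.fst :=
  Measurable.lintegral_prod_left' (f := fun z => P.rnDeriv (P.fst.prod P.snd) z ^ α)
    ((Measure.measurable_rnDeriv _ _).pow_const α)

theorem sibsonIntegral_le_one [IsProbabilityMeasure P] {α : ℝ} (h0 : 0 < α) (h1 : α < 1) :
    sibsonIntegral α P ≤ 1 := by
  have hf : Measurable (P.rnDeriv (P.fst.prod P.snd)) := Measure.measurable_rnDeriv _ _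
  calc sibsonIntegral α P
      ≤ ∫⁻ v, ∫⁻ w, P.rnDeriv (P.fst.prod P.snd) (w, v) ∂P.fst ∂P.snd := by
        refine lintegral_mono fun v => ?_
        have h := ENNReal.lintegral_mul_norm_pow_le (μ := P.fst)
          (hf.comp (measurable_prodMk_right (y := v))).aemeasurable
          (aemeasurable_const (b := (1 : ℝ≥0∞))) h0.le (sub_nonneg.2 h1.le) (by ring)
        simp only [ENNReal.one_rpow, mul_one, lintegral_const, measure_univ,
          Function.comp_apply] at h
        refine (ENNReal.rpow_le_rpow h (by positivity)).trans_eq ?_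
        rw [← ENNReal.rpow_mul, mul_one_div_cancel h0.ne', ENNReal.rpow_one]
    _ = ∫⁻ z, P.rnDeriv (P.fst.prod P.snd) z ∂(P.fst.prod P.snd) :=
        (lintegral_prod_symm' _ hf).symm
    _ ≤ P Set.univ := Measure.lintegral_rnDeriv_le
    _ = 1 := measure_univ

theorem tendsto_reverseHolderBound [IsProbabilityMeasure P] {ℓ : 𝒲 → 𝒱 → ℝ≥0}
    (hℓ : Measurable (Function.uncurry ℓ)) {α : ℝ} (β : ℝ) (h0 : 0 < α) (h1 : α < 1) :
    Tendsto (fun α' : ℝ => reverseHolderBound P ℓ α β α' (α' / (α' - 1))) (𝓝[<] 1)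
      (𝓝 (essInfNorm P.fst P.snd β ℓ * sibsonIntegral α P)) := by
  have hℓ' : Measurable fun z : 𝒲 × 𝒱 => (ℓ z.1 z.2 : ℝ≥0∞) :=
    measurable_coe_nnreal_ennreal.comp hℓ
  have hA : Measurable fun v => (∫⁻ w, (ℓ w v : ℝ≥0∞) ^ β ∂P.fst) ^ (1 / β) :=
    (Measurable.lintegral_prod_left' (f := fun z : 𝒲 × 𝒱 => (ℓ z.1 z.2 : ℝ≥0∞) ^ β)
      (hℓ'.pow_const β)).pow_const _
  have hB := (measurable_lintegral_rnDeriv_rpow P α).pow_const (1 / α)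
  have hJ : sibsonIntegral α P ≠ ∞ :=
    ((sibsonIntegral_le_one P h0 h1).trans_lt ENNReal.one_lt_top).ne
  have hlimA : Tendsto (fun α' : ℝ => nestedNorm P.fst P.snd β (α' / (α' - 1))
      (fun w v => (ℓ w v : ℝ≥0∞))) (𝓝[<] 1) (𝓝 (essInfNorm P.fst P.snd β ℓ)) := by
    simpa only [← ENNReal.rpow_mul, one_div_mul_eq_div, nestedNorm, essInfNorm] using
      tendsto_lintegral_rpow_essInf (ν := P.snd) hA
  have hBeq : ∀ α' : ℝ, nestedNorm P.fst P.snd α α'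
      (fun w v => P.rnDeriv (P.fst.prod P.snd) (w, v)) =
      (∫⁻ v, ((∫⁻ w, P.rnDeriv (P.fst.prod P.snd) (w, v) ^ α ∂P.fst) ^ (1 / α)) ^ α' ∂P.snd) ^
        (1 / α') := by
    intro α'
    simp only [← ENNReal.rpow_mul, one_div_mul_eq_div, nestedNorm]
  -- The essential infimum may be `∞`, and multiplication is discontinuous at `∞ * 0`. When the
  -- second limit is 0, the bound itself vanishes for every `α' > 0`.
  by_cases hz : sibsonIntegral α P = 0
  · rw [hz, mul_zero]
    refine tendsto_const_nhds.congr' ?_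
    have ha : ∀ᶠ a : ℝ in 𝓝[<] 1, 0 < a :=
      (tendsto_id.mono_left nhdsWithin_le_nhds).eventually (lt_mem_nhds one_pos)
    filter_upwards [ha] with a ha0
    have hae := (lintegral_eq_zero_iff hB).1 hz
    have : ∫⁻ v, ((∫⁻ w, P.rnDeriv (P.fst.prod P.snd) (w, v) ^ α ∂P.fst) ^ (1 / α)) ^ a
        ∂P.snd = 0 := by
      refine (lintegral_eq_zero_iff (hB.pow_const a)).2 ?_
      filter_upwards [hae] with v hv
      rw [hv, Pi.zero_apply, ENNReal.zero_rpow_of_pos ha0]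
    rw [reverseHolderBound, hBeq, this, ENNReal.zero_rpow_of_pos (by positivity), mul_zero]
  · refine ENNReal.Tendsto.mul hlimA (Or.inr hJ) ?_ (Or.inl hz)
    simp only [hBeq]
    exact tendsto_lintegral_rpow_one hB hJ

end Mixed

/-- The Hellinger integral `∫ p ^ α q ^ (1 - α) dμ`, where `p`, `q` are the densities of `P`, `Q`
with respect to `μ`. -/
noncomputable def hellingerIntegral {Ω : Type*} [MeasurableSpace Ω] (α : ℝ) (P Q μ : Measure Ω) :
    ℝ≥0∞ :=
  ∫⁻ x, P.rnDeriv μ x ^ α * Q.rnDeriv μ x ^ (1 - α) ∂μ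

/-! ### Hellinger integrals and data processing for the Rényi divergence -/

section Hellinger

variable {Ω : Type*} [MeasurableSpace Ω] {α : ℝ}

/-- By the chain rule both densities acquire the factor `dμ/dν`; as `α + (1 - α) = 1` it comes out
to the first power. -/
theorem hellingerIntegral_eq_of_absolutelyContinuous (h0 : 0 < α) (h1 : α < 1)
    {P Q μ ν : Measure Ω} [IsFiniteMeasure P] [IsFiniteMeasure Q] [IsFiniteMeasure μ]
    [IsFiniteMeasure ν] (hP : P ≪ μ) (hQ : Q ≪ μ) (hμ : μ ≪ ν) :
    hellingerIntegral α P Q ν = hellingerIntegral α P Q μ := by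
  have hm : Measurable fun x => P.rnDeriv μ x ^ α * Q.rnDeriv μ x ^ (1 - α) :=
    ((Measure.measurable_rnDeriv _ _).pow_const _).mul
      ((Measure.measurable_rnDeriv _ _).pow_const _)
  rw [hellingerIntegral, hellingerIntegral, ← lintegral_rnDeriv_mul hμ hm.aemeasurable]
  refine lintegral_congr_ae ?_
  filter_upwards [Measure.rnDeriv_mul_rnDeriv (κ := ν) hP,
    Measure.rnDeriv_mul_rnDeriv (κ := ν) hQ] with x hx hx'
  rw [← hx, ← hx', Pi.mul_apply, Pi.mul_apply, ENNReal.mul_rpow_of_nonneg _ _ h0.le,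
    ENNReal.mul_rpow_of_nonneg _ _ (sub_nonneg.2 h1.le), mul_mul_mul_comm,
    ← ENNReal.rpow_add_of_nonneg _ _ h0.le (sub_nonneg.2 h1.le), add_sub_cancel, ENNReal.rpow_one,
    mul_comm]

theorem rnDeriv_eq_zero_or_of_mutuallySingular {P Q : Measure Ω} (h : P ⟂ₘ Q)
    (μ : Measure Ω) : ∀ᵐ x ∂μ, P.rnDeriv μ x = 0 ∨ Q.rnDeriv μ x = 0 := by
  obtain ⟨s, hs, hPs, hQs⟩ := h
  have key : ∀ (R : Measure Ω) (t : Set Ω), MeasurableSet t → R t = 0 →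
      ∀ᵐ x ∂μ, x ∈ t → R.rnDeriv μ x = 0 := by
    intro R t ht hR
    refine (ae_restrict_iff' ht).1 ((lintegral_eq_zero_iff (Measure.measurable_rnDeriv _ _)).1 ?_)
    exact le_antisymm ((Measure.setLIntegral_rnDeriv_le t).trans_eq hR) zero_le
  filter_upwards [key P s hs hPs, key Q sᶜ hs.compl hQs] with x hx hx'
  by_cases hxs : x ∈ s
  exacts [Or.inl (hx hxs), Or.inr (hx' hxs)]

/-- Singular parts do not contribute: where `Ps` has positive density that of `Q` vanishes, and
symmetrically. Densities are compared over `P + Q + μ`, which dominates everything involved. -/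
theorem hellingerIntegral_add_withDensity (h0 : 0 < α) (h1 : α < 1)
    {P Q Ps Qs μ : Measure Ω} [IsFiniteMeasure P] [IsFiniteMeasure Q] [IsFiniteMeasure μ]
    {f g : Ω → ℝ≥0∞} (hf : Measurable f) (hg : Measurable g)
    (hP : P = Ps + μ.withDensity f) (hQ : Q = Qs + μ.withDensity g)
    (hPs : Ps ⟂ₘ Q) (hQs : Qs ⟂ₘ P) :
    hellingerIntegral α P Q (P + Q) = ∫⁻ x, f x ^ α * g x ^ (1 - α) ∂μ := by
  have : IsFiniteMeasure Ps :=
    isFiniteMeasure_of_le P (by rw [hP]; exact Measure.le_add_right le_rfl)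
  have : IsFiniteMeasure (μ.withDensity f) :=
    isFiniteMeasure_of_le P (by rw [hP]; exact Measure.le_add_left le_rfl)
  have : IsFiniteMeasure Qs :=
    isFiniteMeasure_of_le Q (by rw [hQ]; exact Measure.le_add_right le_rfl)
  have : IsFiniteMeasure (μ.withDensity g) :=
    isFiniteMeasure_of_le Q (by rw [hQ]; exact Measure.le_add_left le_rfl)
  have hPm : P ≪ P + Q := (Measure.le_add_right le_rfl).absolutelyContinuous
  have hQm : Q ≪ P + Q := (Measure.le_add_left le_rfl).absolutelyContinuous
  have hm : P + Q ≪ P + Q + μ := (Measure.le_add_right le_rfl).absolutelyContinuous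
  have hμm : μ ≪ P + Q + μ := (Measure.le_add_left le_rfl).absolutelyContinuous
  rw [← hellingerIntegral_eq_of_absolutelyContinuous h0 h1 hPm hQm hm]
  have h1α : 0 < 1 - α := sub_pos.2 h1
  set m := P + Q + μ
  have hPadd : P.rnDeriv m =ᵐ[m] Ps.rnDeriv m + (μ.withDensity f).rnDeriv m := by
    conv_lhs => rw [hP]
    exact Measure.rnDeriv_add' _ _ _
  have hQadd : Q.rnDeriv m =ᵐ[m] Qs.rnDeriv m + (μ.withDensity g).rnDeriv m := by
    conv_lhs => rw [hQ]
    exact Measure.rnDeriv_add' _ _ _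
  calc hellingerIntegral α P Q m
      = hellingerIntegral α (μ.withDensity f) (μ.withDensity g) m := by
        refine lintegral_congr_ae ?_
        filter_upwards [hPadd, hQadd, rnDeriv_eq_zero_or_of_mutuallySingular hPs m,
          rnDeriv_eq_zero_or_of_mutuallySingular hQs m] with x hpx hqx hps hqs
        simp only [Pi.add_apply] at hpx hqx
        rcases hps with hps | hps
        · rcases hqs with hqs | hqs
          · rw [hpx, hqx, hps, hqs, zero_add, zero_add]
          · rw [hqs, (add_eq_zero.1 (hpx.symm.trans hqs)).2]
            simp [ENNReal.zero_rpow_of_pos h0]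
        · rw [hps, (add_eq_zero.1 (hqx.symm.trans hps)).2]
          simp [ENNReal.zero_rpow_of_pos h1α]
    _ = hellingerIntegral α (μ.withDensity f) (μ.withDensity g) μ :=
        hellingerIntegral_eq_of_absolutelyContinuous h0 h1
          (withDensity_absolutelyContinuous _ _) (withDensity_absolutelyContinuous _ _) hμm
    _ = ∫⁻ x, f x ^ α * g x ^ (1 - α) ∂μ := by
        refine lintegral_congr_ae ?_
        filter_upwards [Measure.rnDeriv_withDensity μ hf, Measure.rnDeriv_withDensity μ hg]
          with x hx hx'
        rw [hx, hx']

/-- Weighted arithmetic-geometric mean, in which the powers of `u` cancel. The choice `u = p / q` is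
optimal, as the next two lemmas show. -/
theorem rpow_mul_rpow_le_weighted (h0 : 0 < α) (h1 : α < 1) (p q u : ℝ≥0∞) :
    p ^ α * q ^ (1 - α) ≤
      ENNReal.ofReal α * (p * u ^ (α - 1)) + ENNReal.ofReal (1 - α) * (q * u ^ α) := by
  have h1α : 0 < 1 - α := sub_pos.2 h1
  have hα : ENNReal.ofReal α ≠ 0 := by simpa using h0
  have hα1 : ENNReal.ofReal (1 - α) ≠ 0 := by simpa using h1
  by_cases hu0 : u = 0
  · by_cases hp : p = 0
    · simp [hp, ENNReal.zero_rpow_of_pos h0]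
    · rw [hu0, ENNReal.zero_rpow_of_neg (by linarith), ENNReal.mul_top hp, ENNReal.mul_top hα,
        top_add]
      exact le_top
  by_cases hut : u = ∞
  · by_cases hq : q = 0
    · simp [hq, ENNReal.zero_rpow_of_pos h1α]
    · rw [hut, ENNReal.top_rpow_of_pos h0, ENNReal.mul_top hq, ENNReal.mul_top hα1, add_top]
      exact le_top
  have hconj : (1 / α).HolderConjugate (1 / (1 - α)) := by
    rw [Real.holderConjugate_iff]
    refine ⟨(one_lt_div h0).2 h1, by simp⟩
  have hY := ENNReal.young_inequality ((p * u ^ (α - 1)) ^ α) ((q * u ^ α) ^ (1 - α)) hconj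
  have hLHS : (p * u ^ (α - 1)) ^ α * (q * u ^ α) ^ (1 - α) = p ^ α * q ^ (1 - α) := by
    rw [ENNReal.mul_rpow_of_nonneg _ _ h0.le, ENNReal.mul_rpow_of_nonneg _ _ h1α.le,
      mul_mul_mul_comm, ← ENNReal.rpow_mul, ← ENNReal.rpow_mul, ← ENNReal.rpow_add _ _ hu0 hut,
      show (α - 1) * α + α * (1 - α) = 0 by ring, ENNReal.rpow_zero, mul_one]
  rw [hLHS, ← ENNReal.rpow_mul, ← ENNReal.rpow_mul, mul_one_div_cancel h0.ne',
    mul_one_div_cancel h1α.ne', ENNReal.rpow_one, ENNReal.rpow_one, one_div, one_div,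
    ENNReal.ofReal_inv_of_pos h0, ENNReal.ofReal_inv_of_pos h1α, div_eq_mul_inv, div_eq_mul_inv,
    inv_inv, inv_inv] at hY
  rwa [mul_comm (ENNReal.ofReal α), mul_comm (ENNReal.ofReal (1 - α))]

theorem mul_div_rpow_sub_one (h0 : 0 < α) (h1 : α < 1) {p q : ℝ≥0∞} (hp : p ≠ ∞) (hq : q ≠ ∞) :
    p * (p / q) ^ (α - 1) = p ^ α * q ^ (1 - α) := by
  have h1α : 0 < 1 - α := sub_pos.2 h1
  by_cases hp0 : p = 0
  · simp [hp0, ENNReal.zero_rpow_of_pos h0]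
  by_cases hq0 : q = 0
  · rw [hq0, ENNReal.div_zero hp0, ENNReal.top_rpow_of_neg (by linarith),
      ENNReal.zero_rpow_of_pos h1α, mul_zero, mul_zero]
  rw [show α - 1 = -(1 - α) by ring, ENNReal.rpow_neg, ← ENNReal.inv_rpow,
    ENNReal.inv_div (Or.inl hq) (Or.inl hq0), ENNReal.div_rpow_of_nonneg _ _ h1α.le,
    div_eq_mul_inv, ← ENNReal.rpow_neg, mul_left_comm]
  nth_rw 1 [← ENNReal.rpow_one p]
  rw [← ENNReal.rpow_add _ _ hp0 hp, mul_comm]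
  congr 2
  ring

theorem mul_div_rpow (h0 : 0 < α) (h1 : α < 1) {p q : ℝ≥0∞} (hq : q ≠ ∞) :
    q * (p / q) ^ α = p ^ α * q ^ (1 - α) := by
  have h1α : 0 < 1 - α := sub_pos.2 h1
  by_cases hq0 : q = 0
  · simp [hq0, ENNReal.zero_rpow_of_pos h1α]
  rw [ENNReal.div_rpow_of_nonneg _ _ h0.le, div_eq_mul_inv, ← ENNReal.rpow_neg, mul_left_comm]
  nth_rw 1 [← ENNReal.rpow_one q]
  rw [← ENNReal.rpow_add _ _ hq0 hq]
  rfl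

/-- Take `u` to be the ratio of the image densities composed with `T`. The weighted bound then
integrates functions of `T` against `P` and `Q`, so it moves to the image space, where this `u`
gives equality. -/
theorem hellingerIntegral_le_map (h0 : 0 < α) (h1 : α < 1) {Ω' : Type*} [MeasurableSpace Ω']
    (P Q : Measure Ω) [IsFiniteMeasure P] [IsFiniteMeasure Q] {T : Ω → Ω'} (hT : Measurable T) :
    hellingerIntegral α P Q (P + Q) ≤
      hellingerIntegral α (P.map T) (Q.map T) (P.map T + Q.map T) := by
  set m' := P.map T + Q.map T
  set p' := (P.map T).rnDeriv m'
  set q' := (Q.map T).rnDeriv m'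
  have hp' : Measurable p' := Measure.measurable_rnDeriv _ _
  have hq' : Measurable q' := Measure.measurable_rnDeriv _ _
  have hu : Measurable fun y => p' y / q' y := hp'.div hq'
  have huT : ∀ s : ℝ, Measurable fun x => (p' (T x) / q' (T x)) ^ s :=
    fun s => (hu.comp hT).pow_const s
  have hPm : P ≪ P + Q := (Measure.le_add_right le_rfl).absolutelyContinuous
  have hQm : Q ≪ P + Q := (Measure.le_add_left le_rfl).absolutelyContinuous
  have hPm' : P.map T ≪ m' := (Measure.le_add_right le_rfl).absolutelyContinuous
  have hQm' : Q.map T ≪ m' := (Measure.le_add_left le_rfl).absolutelyContinuous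
  have hp : Measurable (P.rnDeriv (P + Q)) := Measure.measurable_rnDeriv _ _
  have hq : Measurable (Q.rnDeriv (P + Q)) := Measure.measurable_rnDeriv _ _
  have hpush : ∀ {R : Measure Ω} [IsFiniteMeasure R] (s : ℝ), R ≪ P + Q → R.map T ≪ m' →
      ∫⁻ x, R.rnDeriv (P + Q) x * (p' (T x) / q' (T x)) ^ s ∂(P + Q) =
        ∫⁻ y, (R.map T).rnDeriv m' y * (p' y / q' y) ^ s ∂m' := by
    intro R _ s hR hR'
    rw [lintegral_rnDeriv_mul hR (huT s).aemeasurable,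
      lintegral_rnDeriv_mul hR' (hu.pow_const s).aemeasurable,
      lintegral_map (hu.pow_const s) hT]
  have hfin : ∀ᵐ y ∂m', p' y ≠ ∞ ∧ q' y ≠ ∞ :=
    (Measure.rnDeriv_ne_top _ _).and (Measure.rnDeriv_ne_top _ _)
  calc hellingerIntegral α P Q (P + Q)
      ≤ ∫⁻ x, (ENNReal.ofReal α * (P.rnDeriv (P + Q) x * (p' (T x) / q' (T x)) ^ (α - 1)) +
          ENNReal.ofReal (1 - α) * (Q.rnDeriv (P + Q) x * (p' (T x) / q' (T x)) ^ α)) ∂(P + Q) :=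
        lintegral_mono fun x => rpow_mul_rpow_le_weighted h0 h1 _ _ _
    _ = ENNReal.ofReal α * ∫⁻ y, p' y * (p' y / q' y) ^ (α - 1) ∂m' +
          ENNReal.ofReal (1 - α) * ∫⁻ y, q' y * (p' y / q' y) ^ α ∂m' := by
        have hp1 : Measurable fun x => P.rnDeriv (P + Q) x * (p' (T x) / q' (T x)) ^ (α - 1) :=
          hp.mul (huT _)
        have hq1 : Measurable fun x => Q.rnDeriv (P + Q) x * (p' (T x) / q' (T x)) ^ α :=
          hq.mul (huT _)
        rw [lintegral_add_left (hp1.const_mul _), lintegral_const_mul _ hp1,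
          lintegral_const_mul _ hq1, hpush _ hPm hPm', hpush _ hQm hQm']
    _ = hellingerIntegral α (P.map T) (Q.map T) m' := by
        have e1 : ∫⁻ y, p' y * (p' y / q' y) ^ (α - 1) ∂m' =
            hellingerIntegral α (P.map T) (Q.map T) m' :=
          lintegral_congr_ae (hfin.mono fun y hy => mul_div_rpow_sub_one h0 h1 hy.1 hy.2)
        have e2 : ∫⁻ y, q' y * (p' y / q' y) ^ α ∂m' =
            hellingerIntegral α (P.map T) (Q.map T) m' :=
          lintegral_congr_ae (hfin.mono fun y hy => mul_div_rpow h0 h1 hy.2)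
        rw [e1, e2, ← add_mul, ← ENNReal.ofReal_add h0.le (sub_nonneg.2 h1.le), add_sub_cancel,
          ENNReal.ofReal_one, one_mul]

theorem exp_renyiDiv (α : ℝ) (P Q : Measure Ω) :
    EReal.exp (renyiDiv α P Q) = hellingerIntegral α P Q (P + Q) ^ (α - 1)⁻¹ :=
  (ENNReal.rpow_eq_exp_mul_log _ _).symm

theorem rpow_le_rpow_of_nonpos {x y : ℝ≥0∞} (h : x ≤ y) {s : ℝ} (hs : s ≤ 0) : y ^ s ≤ x ^ s := by
  rw [← neg_neg s, ENNReal.rpow_neg, ENNReal.rpow_neg x]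
  exact ENNReal.inv_le_inv.2 (ENNReal.rpow_le_rpow h (neg_nonneg.2 hs))

theorem renyiDiv_map_le (h0 : 0 < α) (h1 : α < 1) {Ω' : Type*} [MeasurableSpace Ω']
    (P Q : Measure Ω) [IsFiniteMeasure P] [IsFiniteMeasure Q] {T : Ω → Ω'} (hT : Measurable T) :
    renyiDiv α (P.map T) (Q.map T) ≤ renyiDiv α P Q := by
  rw [← EReal.exp_le_exp_iff, exp_renyiDiv, exp_renyiDiv]
  exact rpow_le_rpow_of_nonpos (hellingerIntegral_le_map h0 h1 P Q hT)
    (inv_nonpos.2 (sub_nonpos.2 h1.le))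

end Hellinger

/-! ### Sibson's information: data processing and closed form -/

section Sibson

variable {𝒲 𝒳 𝒱 : Type*} [MeasurableSpace 𝒲] [MeasurableSpace 𝒳] [MeasurableSpace 𝒱] {α : ℝ}

/-- Each competitor `Q` for `P` is matched with its image under `φ`, since `id × φ` sends `P.fst ⊗
Q` to `P.fst ⊗ φ_* Q`. -/
theorem sibsonInfo_map_le (h0 : 0 < α) (h1 : α < 1) (P : Measure (𝒲 × 𝒳)) [IsFiniteMeasure P]
    {φ : 𝒳 → 𝒱} (hφ : Measurable φ) :
    sibsonInfo α (P.map fun z => (z.1, φ z.2)) ≤ sibsonInfo α P := by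
  refine le_iInf fun Q => iInf_le_of_le (Q.map hφ.aemeasurable) ?_
  have hT : Measurable fun z : 𝒲 × 𝒳 => (z.1, φ z.2) :=
    measurable_fst.prodMk (hφ.comp measurable_snd)
  have hfst : (P.map fun z => (z.1, φ z.2)).fst = P.fst := by
    rw [Measure.fst, Measure.map_map measurable_fst hT]; rfl
  have hprod : (P.fst.prod (Q : Measure 𝒳)).map (fun z => (z.1, φ z.2)) =
      P.fst.prod ((Q : Measure 𝒳).map φ) := by
    have := Measure.map_prod_map P.fst (Q : Measure 𝒳) measurable_id hφ
    rw [Measure.map_id] at this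
    exact this.symm
  rw [hfst, ProbabilityMeasure.toMeasure_map, ← hprod]
  exact renyiDiv_map_le h0 h1 P _ hT

variable (P : Measure (𝒲 × 𝒱)) [IsProbabilityMeasure P]

theorem lintegral_rnDeriv_prod_mul {g : 𝒱 → ℝ≥0∞} (hg : Measurable g) :
    ∫⁻ z, P.rnDeriv (P.fst.prod P.snd) z ^ α * g z.2 ∂(P.fst.prod P.snd) =
      ∫⁻ v, (∫⁻ w, P.rnDeriv (P.fst.prod P.snd) (w, v) ^ α ∂P.fst) * g v ∂P.snd := by
  have hf : Measurable fun z => P.rnDeriv (P.fst.prod P.snd) z ^ α :=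
    (Measure.measurable_rnDeriv _ _).pow_const α
  rw [lintegral_prod_symm' (fun z => P.rnDeriv (P.fst.prod P.snd) z ^ α * g z.2)
    (hf.mul (hg.comp measurable_snd))]
  refine lintegral_congr fun v => ?_
  have hfv : Measurable fun w => P.rnDeriv (P.fst.prod P.snd) (w, v) ^ α :=
    hf.comp measurable_prodMk_right
  exact lintegral_mul_const (g v) hfv

theorem hellingerIntegral_prod (h0 : 0 < α) (h1 : α < 1) (Q : Measure 𝒱) [IsFiniteMeasure Q] :
    hellingerIntegral α P (P.fst.prod Q) (P + P.fst.prod Q) =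
      ∫⁻ v, (∫⁻ w, P.rnDeriv (P.fst.prod P.snd) (w, v) ^ α ∂P.fst) *
        Q.rnDeriv P.snd v ^ (1 - α) ∂P.snd := by
  have hq : Measurable (Q.rnDeriv P.snd) := Measure.measurable_rnDeriv _ _
  set Qs := Q.singularPart P.snd
  have hQ : P.fst.prod Q = P.fst.prod Qs +
      (P.fst.prod P.snd).withDensity (fun z => Q.rnDeriv P.snd z.2) := by
    rw [← prod_withDensity_right hq, ← Measure.prod_add, ← Q.haveLebesgueDecomposition_add P.snd]
  -- `Qs` lives on a `P.snd`-null set, and the cylinder over that set is `P`-null.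
  have hQs : P.fst.prod Qs ⟂ₘ P := by
    obtain ⟨s, hs, hQs, hνs⟩ := Q.mutuallySingular_singularPart P.snd
    refine ⟨Prod.snd ⁻¹' s, measurable_snd hs, ?_, ?_⟩
    · rw [← Set.univ_prod, Measure.prod_prod, hQs, mul_zero]
    · rw [← Set.preimage_compl, ← Measure.snd_apply hs.compl]
      exact hνs
  have hPs : P.singularPart (P.fst.prod P.snd) ⟂ₘ P.fst.prod Q := by
    rw [hQ]
    refine Measure.MutuallySingular.add_right ?_ ?_
    · exact (hQs.mono_ac Measure.AbsolutelyContinuous.rfl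
        (Measure.singularPart_le _ _).absolutelyContinuous).symm
    · exact (P.mutuallySingular_singularPart _).mono_ac Measure.AbsolutelyContinuous.rfl
        (withDensity_absolutelyContinuous _ _)
  rw [hellingerIntegral_add_withDensity h0 h1 (Measure.measurable_rnDeriv P (P.fst.prod P.snd))
    (hq.comp measurable_snd) (P.haveLebesgueDecomposition_add _) hQ hPs hQs]
  exact lintegral_rnDeriv_prod_mul P (hq.pow_const _)

theorem hellingerIntegral_prod_le (h0 : 0 < α) (h1 : α < 1) (Q : Measure 𝒱)
    [IsProbabilityMeasure Q] :
    hellingerIntegral α P (P.fst.prod Q) (P + P.fst.prod Q) ≤ sibsonIntegral α P ^ α := by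
  rw [hellingerIntegral_prod P h0 h1]
  have hB := measurable_lintegral_rnDeriv_rpow P α
  have h := ENNReal.lintegral_mul_norm_pow_le (μ := P.snd)
    (hB.pow_const (1 / α)).aemeasurable
    (Measure.measurable_rnDeriv Q P.snd).aemeasurable h0.le (sub_nonneg.2 h1.le) (by ring)
  simp only [← ENNReal.rpow_mul, one_div_mul_cancel h0.ne', ENNReal.rpow_one] at h
  refine h.trans ?_
  calc sibsonIntegral α P ^ α * (∫⁻ v, Q.rnDeriv P.snd v ∂P.snd) ^ (1 - α)
      ≤ sibsonIntegral α P ^ α * 1 := by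
        gcongr
        refine ENNReal.rpow_le_one ?_ (sub_nonneg.2 h1.le)
        exact Measure.lintegral_rnDeriv_le.trans_eq measure_univ
    _ = sibsonIntegral α P ^ α := mul_one _

/-- The witness is the equality case of Hölder in the preceding bound: density `b ^ (1 / α)`,
normalized by its integral `J`. -/
theorem exists_hellingerIntegral_prod_eq (h0 : 0 < α) (h1 : α < 1)
    (hJ : sibsonIntegral α P ≠ 0) : ∃ Q : ProbabilityMeasure 𝒱,
      hellingerIntegral α P (P.fst.prod (Q : Measure 𝒱)) (P + P.fst.prod (Q : Measure 𝒱)) =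
        sibsonIntegral α P ^ α := by
  have h1α : 0 < 1 - α := sub_pos.2 h1
  set J := sibsonIntegral α P
  have hJt : J ≠ ∞ := ((sibsonIntegral_le_one P h0 h1).trans_lt ENNReal.one_lt_top).ne
  set b : 𝒱 → ℝ≥0∞ := fun v => ∫⁻ w, P.rnDeriv (P.fst.prod P.snd) (w, v) ^ α ∂P.fst
  have hb : Measurable b := measurable_lintegral_rnDeriv_rpow P α
  have hb' : Measurable fun v => b v ^ (1 / α) := hb.pow_const _
  have hd : Measurable fun v => b v ^ (1 / α) * J⁻¹ := hb'.mul_const _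
  have hprob : IsProbabilityMeasure (P.snd.withDensity fun v => b v ^ (1 / α) * J⁻¹) := by
    refine ⟨?_⟩
    rw [withDensity_apply _ MeasurableSet.univ, Measure.restrict_univ, lintegral_mul_const _ hb']
    exact ENNReal.mul_inv_cancel hJ hJt
  refine ⟨⟨_, hprob⟩, ?_⟩
  rw [ProbabilityMeasure.coe_mk, hellingerIntegral_prod P h0 h1]
  calc ∫⁻ v, b v * (P.snd.withDensity fun v => b v ^ (1 / α) * J⁻¹).rnDeriv P.snd v ^ (1 - α)
        ∂P.snd
      = ∫⁻ v, b v ^ (1 / α) * (J⁻¹) ^ (1 - α) ∂P.snd := by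
        refine lintegral_congr_ae ?_
        filter_upwards [Measure.rnDeriv_withDensity P.snd hd] with v hv
        rw [hv, ENNReal.mul_rpow_of_nonneg _ _ h1α.le, ← mul_assoc]
        congr 1
        nth_rw 1 [← ENNReal.rpow_one (b v)]
        rw [← ENNReal.rpow_mul, ← ENNReal.rpow_add_of_nonneg _ _ zero_le_one (by positivity)]
        congr 1
        field_simp
        ring
    _ = J * (J⁻¹) ^ (1 - α) := lintegral_mul_const _ hb'
    _ = J ^ α := by
        rw [ENNReal.inv_rpow, ← ENNReal.rpow_neg]
        nth_rw 1 [← ENNReal.rpow_one J]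
        rw [← ENNReal.rpow_add _ _ hJ hJt]
        congr 1
        ring

theorem exp_sibsonInfo (h0 : 0 < α) (h1 : α < 1) :
    EReal.exp (sibsonInfo α P) = sibsonIntegral α P ^ (α / (α - 1)) := by
  have hneg : (α - 1)⁻¹ < 0 := inv_lt_zero.2 (sub_neg.2 h1)
  have hinf : EReal.exp (sibsonInfo α P) = ⨅ Q : ProbabilityMeasure 𝒱,
      hellingerIntegral α P (P.fst.prod (Q : Measure 𝒱)) (P + P.fst.prod (Q : Measure 𝒱)) ^
        (α - 1)⁻¹ := by
    simp only [← exp_renyiDiv]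
    exact EReal.expOrderIso.map_iInf _
  rw [hinf, div_eq_mul_inv, ENNReal.rpow_mul]
  refine le_antisymm ?_ (le_iInf fun Q =>
    rpow_le_rpow_of_nonpos (hellingerIntegral_prod_le P h0 h1 Q) hneg.le)
  -- For `J = 0` no minimizer is needed, as the claimed value is `∞`.
  by_cases hJ : sibsonIntegral α P = 0
  · rw [hJ, ENNReal.zero_rpow_of_pos h0, ENNReal.zero_rpow_of_neg hneg]
    exact le_top
  · obtain ⟨Q, hQ⟩ := exists_hellingerIntegral_prod_eq P h0 h1 hJ
    exact iInf_le_of_le Q (by rw [hQ])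

theorem exp_mul_sibsonInfo (h0 : 0 < α) (h1 : α < 1) :
    EReal.exp ((((α - 1) / α : ℝ) : EReal) * sibsonInfo α P) = sibsonIntegral α P := by
  have : α - 1 ≠ 0 := by linarith
  rw [mul_comm, EReal.exp_mul, exp_sibsonInfo P h0 h1, ← ENNReal.rpow_mul,
    div_mul_div_cancel₀ this, div_self h0.ne', ENNReal.rpow_one]

end Sibson

end BayesFramework

/-! ### Assembly of the bounds -/

theorem mainTheorem10 {𝒲 𝒳 𝒱 : Type*}
    [MeasurableSpace 𝒲] [MeasurableSpace 𝒳] [MeasurableSpace 𝒱]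
    (PW : Measure 𝒲) [IsProbabilityMeasure PW]
    (K : Kernel 𝒲 𝒳) [IsMarkovKernel K]
    (ℓ : 𝒲 → 𝒱 → ℝ≥0) (hℓ : Measurable (Function.uncurry ℓ)) :
    -- the nested-norm bound, for every estimator and all admissible exponents
    (∀ φ : 𝒳 → 𝒱, Measurable φ → ∀ α β α' β' : ℝ,
      α < 1 → α ≠ 0 → α' < 1 → α' ≠ 0 → 1 / α + 1 / β = 1 → 1 / α' + 1 / β' = 1 →
      BayesFramework.reverseHolderBound (BayesFramework.estimatorLaw PW K φ) ℓ α β α' β' ≤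
        BayesFramework.expectedLoss PW K ℓ φ) ∧
    (∀ α β : ℝ, 0 < α → α < 1 → 1 / α + 1 / β = 1 →
      -- the limit `α' → 1⁻` (with `β' = α' / (α' - 1) → -∞`) of the nested-norm bound
      (∀ φ : 𝒳 → 𝒱, Measurable φ →
        Tendsto (fun α' : ℝ => BayesFramework.reverseHolderBound
            (BayesFramework.estimatorLaw PW K φ) ℓ α β α' (α' / (α' - 1)))
          (𝓝[<] 1)
          (𝓝 (BayesFramework.essInfNorm PW (BayesFramework.estimatorLaw PW K φ).snd β ℓ *
            EReal.exp ((((α - 1) / α : ℝ) : EReal) *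
              BayesFramework.sibsonInfo α (BayesFramework.estimatorLaw PW K φ))))) ∧
      -- the bound through `I_α(W, X)`, for every estimator
      (∀ φ : 𝒳 → 𝒱, Measurable φ →
        BayesFramework.essInfNorm PW (BayesFramework.estimatorLaw PW K φ).snd β ℓ *
            EReal.exp ((((α - 1) / α : ℝ) : EReal) * BayesFramework.sibsonInfo α (PW ⊗ₘ K)) ≤
          BayesFramework.expectedLoss PW K ℓ φ) ∧
      -- the lower bound on the Bayes risk
      (⨅ (φ : 𝒳 → 𝒱) (_ : Measurable φ),
          BayesFramework.essInfNorm PW (BayesFramework.estimatorLaw PW K φ).snd β ℓ) *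
          EReal.exp ((((α - 1) / α : ℝ) : EReal) * BayesFramework.sibsonInfo α (PW ⊗ₘ K)) ≤
        BayesFramework.bayesRisk PW K ℓ) := by
  have hlaw : ∀ φ : 𝒳 → 𝒱, Measurable φ →
      IsProbabilityMeasure (BayesFramework.estimatorLaw PW K φ) ∧
        (BayesFramework.estimatorLaw PW K φ).fst = PW := by
    intro φ hφ
    have hT : Measurable fun z : 𝒲 × 𝒳 => (z.1, φ z.2) :=
      measurable_fst.prodMk (hφ.comp measurable_snd)
    refine ⟨Measure.isProbabilityMeasure_map hT.aemeasurable, ?_⟩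
    rw [BayesFramework.estimatorLaw, Measure.fst, Measure.map_map measurable_fst hT]
    exact Measure.fst_compProd PW K
  have hbound : ∀ φ : 𝒳 → 𝒱, Measurable φ → ∀ α β α' β' : ℝ,
      α < 1 → α ≠ 0 → α' < 1 → α' ≠ 0 → 1 / α + 1 / β = 1 → 1 / α' + 1 / β' = 1 →
      BayesFramework.reverseHolderBound (BayesFramework.estimatorLaw PW K φ) ℓ α β α' β' ≤
        BayesFramework.expectedLoss PW K ℓ φ := by
    intro φ hφ α β α' β' hα hα0 hα' hα'0 h h'
    have := (hlaw φ hφ).1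
    exact BayesFramework.reverseHolderBound_le _ hℓ hα hα0 hα' hα'0 h h'
  refine ⟨hbound, fun α β h0 h1 hαβ => ?_⟩
  have hlim : ∀ φ : 𝒳 → 𝒱, Measurable φ →
      Tendsto (fun α' : ℝ => BayesFramework.reverseHolderBound
          (BayesFramework.estimatorLaw PW K φ) ℓ α β α' (α' / (α' - 1)))
        (𝓝[<] 1)
        (𝓝 (BayesFramework.essInfNorm PW (BayesFramework.estimatorLaw PW K φ).snd β ℓ *
          EReal.exp ((((α - 1) / α : ℝ) : EReal) *
            BayesFramework.sibsonInfo α (BayesFramework.estimatorLaw PW K φ)))) := by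
    intro φ hφ
    obtain ⟨hprob, hfst⟩ := hlaw φ hφ
    have := BayesFramework.tendsto_reverseHolderBound (BayesFramework.estimatorLaw PW K φ) hℓ β
      h0 h1
    rwa [hfst, ← BayesFramework.exp_mul_sibsonInfo _ h0 h1] at this
  have hφbound : ∀ φ : 𝒳 → 𝒱, Measurable φ →
      BayesFramework.essInfNorm PW (BayesFramework.estimatorLaw PW K φ).snd β ℓ *
          EReal.exp ((((α - 1) / α : ℝ) : EReal) * BayesFramework.sibsonInfo α (PW ⊗ₘ K)) ≤
        BayesFramework.expectedLoss PW K ℓ φ := by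
    intro φ hφ
    calc _ ≤ BayesFramework.essInfNorm PW (BayesFramework.estimatorLaw PW K φ).snd β ℓ *
          EReal.exp ((((α - 1) / α : ℝ) : EReal) *
            BayesFramework.sibsonInfo α (BayesFramework.estimatorLaw PW K φ)) := by
          -- As powers of `exp I_α` with the negative exponent `(α - 1) / α`, the two factors are
          -- ordered oppositely to the informations.
          rw [mul_comm (((α - 1) / α : ℝ) : EReal), mul_comm (((α - 1) / α : ℝ) : EReal),
            EReal.exp_mul, EReal.exp_mul]
          refine mul_le_mul_right ?_ _
          exact BayesFramework.rpow_le_rpow_of_nonpos (EReal.exp_le_exp_iff.2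
            (BayesFramework.sibsonInfo_map_le h0 h1 (PW ⊗ₘ K) hφ))
            (div_nonpos_of_nonpos_of_nonneg (sub_nonpos.2 h1.le) h0.le)
      _ ≤ BayesFramework.expectedLoss PW K ℓ φ := by
          have ha : ∀ᶠ a : ℝ in 𝓝[<] 1, 0 < a :=
            (tendsto_id.mono_left nhdsWithin_le_nhds).eventually (lt_mem_nhds one_pos)
          -- The nested bound holds for every `α'` in `(0, 1)`, hence so does its limit.
          refine le_of_tendsto (hlim φ hφ) ?_
          filter_upwards [ha, self_mem_nhdsWithin] with a ha0 ha1
          refine hbound φ hφ α β a _ h1 h0.ne' ha1 ha0.ne' hαβ ?_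
          rw [one_div_div, ← add_div, add_sub_cancel, div_self ha0.ne']
  refine ⟨hlim, hφbound, le_iInf₂ fun φ hφ => le_trans ?_ (hφbound φ hφ)⟩
  gcongr
  exact iInf₂_le φ hφ
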